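/- Let $K$ be a number field of degree $d=[K:\mathbb{Q}]$. For $x=(x_0:x_1)\in\mathbb{P}^1(K)$ let $$H(x)=\Bigl(\prod_{v}\max(|x_0|_v,|x_1|_v)\Bigr)^{1/d}$$ be the absolute height, the product being over all places $v$ of $K$ with the normalised absolute values (the usual one for real $v$, the square of the usual one for complex $v$, and $|\pi|_v=1/q_v$ for a uniformiser $\pi$ at a finite place with residue field of $q_v$ elements). For every real $N$ the set $\{x\in\mathbb{P}^1(K): H(x)\le N\}$ is finite. A subset $A\subseteq\mathbb{P}^1(K)$ is said to have height density $\delta$ if $$\liminf_{N\to\infty}\frac{\#\{x\in A: H(x)\le N\}}{\#\{x\in\mathbb{P}^1(K): H(x)\le N\}}=\limsup_{N\to\infty}\frac{\#\{x\in A: H(x)\le N\}}{\#\{x\in\mathbb{P}^1(K): H(x)\le N\}}=\delta .$$ Let $f_1,\dots,f_n\in K(t)$ be rational functions, regarded as maps $\mathbb{P}^1(K)\to\mathbb{P}^1(K)$, each of degree at least $2$ (the degree of $p/q$ in lowest terms being $\max(\deg p,\deg q)$), and let $x_0\in\mathbb{P}^1(K)$. Assume that the family $(f_1,\dots,f_n)$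 is injective at $x_0$, that is, the map from the free monoid on $n$ letters to $\mathbb{P}^1(K)$ which sends a word $i_1i_2\cdots i_r$ to $(f_{i_1}\circ f_{i_2}\circ\cdots\circ f_{i_r})(x_0)$ (and the empty word to $x_0$) is injective. Let $\Gamma$ be the monoid generated by $f_1,\dots,f_n$ under composition, and let $\Gamma(x_0)=\{\gamma(x_0):\gamma\in\Gamma\}$. Then $\Gamma(x_0)$ has height density $0$. Moreover, there is a positive integer $k$ such that, as $N\to\infty$, $$\#\{x\in\Gamma(x_0): H(x)\le N\}=O\bigl((\log N)^k\bigr).$$ -/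

import Mathlib

open Polynomial Filter Topology Asymptotics
open scoped LinearAlgebra.Projectivization

noncomputable section

namespace RationalOrbit

variable {K : Type*} [Field K]

/-- The degree of the rational map `f = p / q` (in lowest terms): `max (deg p) (deg q)`. -/
def degree (f : RatFunc K) : ℕ := max f.num.natDegree f.denom.natDegree

/-- The homogeneous lift of `f = p / q` (in lowest terms, of degree `d`) to `K²`:
`(x, y) ↦ (y ^ d * p (x / y), y ^ d * q (x / y))`, both entries being read as homogeneous
polynomials of degree `d` in `x` and `y`. -/
def homLift (f : RatFunc K) (v : Fin 2 → K) : Fin 2 → K :=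
  ![MvPolynomial.eval v (f.num.homogenize (degree f)),
    MvPolynomial.eval v (f.denom.homogenize (degree f))]

theorem eval_homogenize_eq_sum (p : K[X]) (n : ℕ) (v : Fin 2 → K) :
    MvPolynomial.eval v (p.homogenize n) =
      ∑ kl ∈ Finset.HasAntidiagonal.antidiagonal n, p.coeff kl.1 * (v 0 ^ kl.1 * v 1 ^ kl.2) := by
  rw [Polynomial.homogenize, MvPolynomial.eval_sum]
  refine Finset.sum_congr rfl fun kl _ => ?_
  rw [MvPolynomial.eval_monomial, Finsupp.prod_fintype _ _ (by simp), Fin.prod_univ_two]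
  simp

theorem eval_homogenize_smul (p : K[X]) (n : ℕ) (t : K) (v : Fin 2 → K) :
    MvPolynomial.eval (t • v) (p.homogenize n) = t ^ n * MvPolynomial.eval v (p.homogenize n) := by
  rw [eval_homogenize_eq_sum, eval_homogenize_eq_sum, Finset.mul_sum]
  refine Finset.sum_congr rfl fun kl hkl => ?_
  rw [← Finset.HasAntidiagonal.mem_antidiagonal.1 hkl]
  simp only [Pi.smul_apply, smul_eq_mul]
  ring

theorem homLift_smul (f : RatFunc K) (t : K) (v : Fin 2 → K) :
    homLift f (t • v) = t ^ degree f • homLift f v := by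
  ext i
  fin_cases i <;> simp [homLift, eval_homogenize_smul]

theorem eval_homogenize_one_zero (p : K[X]) (n : ℕ) :
    MvPolynomial.eval ![1, 0] (p.homogenize n) = p.coeff n := by
  rw [eval_homogenize_eq_sum, Finset.sum_eq_single (n, 0)]
  · simp
  · rintro ⟨k, l⟩ hkl hne
    have hl : l ≠ 0 := by
      rintro rfl
      exact hne (by simpa using hkl)
    simp [hl]
  · simp

theorem homLift_ne_zero (f : RatFunc K) {v : Fin 2 → K} (hv : v ≠ 0) : homLift f v ≠ 0 := by
  intro h
  have h0 : MvPolynomial.eval v (f.num.homogenize (degree f)) = 0 := congrFun h 0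
  have h1 : MvPolynomial.eval v (f.denom.homogenize (degree f)) = 0 := congrFun h 1
  by_cases hy : v 1 = 0
  · have hx : v 0 ≠ 0 := fun hx => hv (by ext i; fin_cases i <;> simp [hx, hy])
    have hv' : v = v 0 • ![1, 0] := by ext i; fin_cases i <;> simp [hy]
    rw [hv', eval_homogenize_smul, eval_homogenize_one_zero] at h0 h1
    have hc0 := (mul_eq_zero.1 h0).resolve_left (pow_ne_zero _ hx)
    have hc1 := (mul_eq_zero.1 h1).resolve_left (pow_ne_zero _ hx)
    rcases le_or_gt f.num.natDegree f.denom.natDegree with hle | hlt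
    · rw [degree, max_eq_right hle, coeff_natDegree, leadingCoeff_eq_zero] at hc1
      exact f.denom_ne_zero hc1
    · rw [degree, max_eq_left hlt.le, coeff_natDegree, leadingCoeff_eq_zero] at hc0
      simp [hc0] at hlt
  · rw [eval_homogenize (n := degree f) (le_max_left _ _) v hy] at h0
    rw [eval_homogenize (n := degree f) (le_max_right _ _) v hy] at h1
    have h0' := (mul_eq_zero.1 h0).resolve_right (pow_ne_zero _ hy)
    have h1' := (mul_eq_zero.1 h1).resolve_right (pow_ne_zero _ hy)
    obtain ⟨a, b, hab⟩ := f.isCoprime_num_denom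
    have := congrArg (Polynomial.eval (v 0 / v 1)) hab
    simp [h0', h1'] at this

/-- The self-map of `ℙ¹(K)` given by the rational function `f`. -/
def toMap (f : RatFunc K) : Function.End (ℙ K (Fin 2 → K)) :=
  Projectivization.lift
    (fun v => Projectivization.mk K (homLift f v.1) (homLift_ne_zero f v.2)) (by
      intro a b t h
      rw [Projectivization.mk_eq_mk_iff']
      exact ⟨t ^ degree f, by rw [h, homLift_smul]⟩)

/-- The evaluation map `Ω` from the free monoid on `n` letters to `ℙ¹(K)`: the word
`i₁ i₂ ⋯ iᵣ` goes to `(f_{i₁} ∘ f_{i₂} ∘ ⋯ ∘ f_{iᵣ}) x₀`. -/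
def evaluation {n : ℕ} (f : Fin n → RatFunc K) (x₀ : ℙ K (Fin 2 → K))
    (w : FreeMonoid (Fin n)) : ℙ K (Fin 2 → K) :=
  FreeMonoid.lift (fun i => toMap (f i)) w x₀

/-- The family `f` is injective at `x₀`. -/
def IsInjectiveAt {n : ℕ} (f : Fin n → RatFunc K) (x₀ : ℙ K (Fin 2 → K)) : Prop :=
  Function.Injective (evaluation f x₀)

/-- The monoid (under composition) of self-maps of `ℙ¹(K)` generated by the family `f`. -/
def generatedMonoid {n : ℕ} (f : Fin n → RatFunc K) : Submonoid (Function.End (ℙ K (Fin 2 → K))) :=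
  Submonoid.closure (Set.range fun i => toMap (f i))

/-- The orbit `Γ(x₀)` of `x₀` under the monoid `Γ` generated by the family `f`. -/
def orbit {n : ℕ} (f : Fin n → RatFunc K) (x₀ : ℙ K (Fin 2 → K)) : Set (ℙ K (Fin 2 → K)) :=
  {x | ∃ γ ∈ generatedMonoid f, γ x₀ = x}

variable [NumberField K]

/-- The absolute (multiplicative) height on `ℙ¹(K)`: the `[K : ℚ]`-th root of the height
relative to `K`. -/
def absHeight (x : ℙ K (Fin 2 → K)) : ℝ :=
  x.mulHeight ^ ((Module.finrank ℚ K : ℝ)⁻¹)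

/-- The points of `A` of absolute height at most `N`. -/
def heightBall (A : Set (ℙ K (Fin 2 → K))) (N : ℝ) : Set (ℙ K (Fin 2 → K)) :=
  {x | x ∈ A ∧ absHeight x ≤ N}

/-- The proportion of the points of `ℙ¹(K)` of height at most `N` that lie in `A`. -/
def heightProportion (A : Set (ℙ K (Fin 2 → K))) (N : ℝ) : ℝ :=
  ((heightBall A N).ncard : ℝ) /
    ((heightBall (Set.univ : Set (ℙ K (Fin 2 → K))) N).ncard : ℝ)

/-- The lower height density. -/
def lowerHeightDensity (A : Set (ℙ K (Fin 2 → K))) : ℝ :=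
  liminf (heightProportion A) atTop

/-- The upper height density. -/
def upperHeightDensity (A : Set (ℙ K (Fin 2 → K))) : ℝ :=
  limsup (heightProportion A) atTop

/-- `A` has height density `δ`. -/
def HasHeightDensity (A : Set (ℙ K (Fin 2 → K))) (δ : ℝ) : Prop :=
  lowerHeightDensity A = δ ∧ upperHeightDensity A = δ

end RationalOrbit

end

/-! A rational map of degree at least 2 at least doubles the logarithmic height up to a bounded
error (`exists_degree_mul_logHeight_sub_le`). By Northcott and injectivity at `x₀`, all but finitely
many words have values so high that this error is absorbed, so heights grow at least like `(3/2) ^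
r` in the word length (`exists_pow_le_height_lift`). Logarithmic height at most `B` thus forces word
length `O(log B)`. Words of length at most `R` take at most `(n + 1) ^ R` values, so the count is
polynomial in `B`, that is, in `log N`. Density zero follows because `ℙ¹(K)` has at least `N` points
of height at most `N`, the naturals alone sufficing. -/

namespace RationalOrbit

/-! ### Bézout identities with degree control -/

section Bezout

variable {K : Type*} [Field K]

/-- Multiply a Bézout relation by `X ^ (M + d)` and reduce the coefficient of `q` modulo `p`;
comparing degrees then bounds the coefficient of `p`. -/
theorem exists_mul_add_mul_eq_X_pow {p q : K[X]} {d M : ℕ} (hpq : IsCoprime p q)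
    (hp : p.natDegree = d) (hq : q.natDegree ≤ d) (hM : d ≤ M) :
    ∃ u v : K[X], u.natDegree ≤ M ∧ v.natDegree ≤ M ∧ u * p + v * q = X ^ (M + d) := by
  obtain ⟨a, b, hab⟩ := hpq
  rcases eq_or_ne p 0 with rfl | hp0
  · obtain rfl : d = 0 := by simpa using hp.symm
    have hb : b * q = 1 := by simpa using hab
    obtain ⟨c, hc⟩ := Polynomial.natDegree_eq_zero.1 (Nat.le_zero.1 hq)
    have hc0 : c ≠ 0 := by
      rintro rfl
      simp [← hc] at hb
    refine ⟨0, C c⁻¹ * X ^ M, by simp, (natDegree_C_mul_X_pow_le _ _), ?_⟩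
    rw [← hc, zero_mul, zero_add, mul_right_comm, ← C_mul, inv_mul_cancel₀ hc0]
    simp
  set V := b * X ^ (M + d) with hV
  have key : (a * X ^ (M + d) + V / p * q) * p + V % p * q = X ^ (M + d) := by
    have h1 : p * (V / p) + V % p = V := EuclideanDomain.div_add_mod V p
    linear_combination X ^ (M + d) * hab + q * h1 - q * hV
  have hv : (V % p).natDegree ≤ d := hp ▸ natDegree_le_natDegree (degree_mod_lt V hp0).le
  refine ⟨_, _, ?_, hv.trans hM, key⟩
  set u := a * X ^ (M + d) + V / p * q
  rcases eq_or_ne u 0 with hu | hu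
  · simp [hu]
  have h2 : (u * p).natDegree ≤ M + d := by
    rw [eq_sub_of_add_eq key]
    refine (natDegree_sub_le _ _).trans (max_le (natDegree_X_pow_le _) ?_)
    exact natDegree_mul_le.trans (add_le_add (hv.trans hM) hq)
  rw [natDegree_mul hu hp0, hp] at h2
  omega

theorem exists_natDegree_le_mul_num_add_mul_denom_eq_X_pow (f : RatFunc K) {M : ℕ}
    (hM : degree f ≤ M) :
    ∃ u v : K[X], u.natDegree ≤ M ∧ v.natDegree ≤ M ∧
      u * f.num + v * f.denom = X ^ (M + degree f) := by
  rcases le_total f.num.natDegree f.denom.natDegree with h | h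
  · obtain ⟨u, v, hu, hv, huv⟩ := exists_mul_add_mul_eq_X_pow (d := degree f)
      f.isCoprime_num_denom.symm (max_eq_right h).symm (le_max_left _ _) hM
    exact ⟨v, u, hv, hu, by rw [add_comm, huv]⟩
  · exact exists_mul_add_mul_eq_X_pow f.isCoprime_num_denom (max_eq_left h).symm
      (le_max_right _ _) hM

end Bezout

/-! ### Height growth under a rational map -/

section HeightGrowth

variable {K : Type*} [Field K] [Height.AdmissibleAbsValues K]

/-- A rational map of degree `d` multiplies the logarithmic height by at least `d`, up to a
bounded error. -/
theorem exists_degree_mul_logHeight_sub_le (f : RatFunc K) :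
    ∃ C : ℝ, ∀ x : ℙ K (Fin 2 → K),
      degree f * x.logHeight - C ≤ (toMap f x).logHeight := by
  obtain ⟨a, b, hab⟩ := f.isCoprime_num_denom
  set d := degree f with hd
  obtain ⟨M, hdM, haM, hbM⟩ : ∃ M, d ≤ M ∧ a.natDegree ≤ M ∧ b.natDegree ≤ M :=
    ⟨d + a.natDegree + b.natDegree, by omega, by omega, by omega⟩
  obtain ⟨u, v, huM, hvM, huv⟩ := exists_natDegree_le_mul_num_add_mul_denom_eq_X_pow f hdM
  let p : Fin 2 → MvPolynomial (Fin 2) K := ![f.num.homogenize d, f.denom.homogenize d]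
  -- Writing `x, y` for the coordinates, row 0 expresses `x ^ (M + d)` and row 1 expresses `y ^ (M +
  -- d)` (the homogenization of `1`) through the two forms defining `f`; such certificates bound the
  -- height from below.
  let q : Fin 2 × Fin 2 → MvPolynomial (Fin 2) K :=
    fun kj => (![![u, v], ![a, b]] kj.1 kj.2).homogenize M
  obtain ⟨C, hC⟩ := Height.logHeight_eval_ge' (M := M) (N := d) (q := q)
    fun _ => isHomogeneous_homogenize _
  have homog (s t : K[X]) (hs : s.natDegree ≤ M) (ht : t.natDegree ≤ M) :
      s.homogenize M * f.num.homogenize d + t.homogenize M * f.denom.homogenize d =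
        (s * f.num + t * f.denom).homogenize (M + d) := by
    rw [homogenize_add, homogenize_mul (n := d) _ _ hs (le_max_left _ _),
      homogenize_mul (n := d) _ _ ht (le_max_right _ _)]
  refine ⟨-C, fun x => ?_⟩
  induction x using Projectivization.ind with
  | h w hw =>
  have key := hC p (x := w) fun k => by
    simp only [Fin.sum_univ_two, ← map_mul, ← map_add]
    fin_cases k
    · simp [p, q, homog u v huM hvM, huv, ← hd]
    · simp [p, q, homog a b haM hbM, hab]
  have himg : toMap f (Projectivization.mk K w hw) =
      Projectivization.mk K (homLift f w) (homLift_ne_zero f hw) := rfl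
  have hp : (fun j => (p j).eval w) = homLift f w := by
    ext j
    fin_cases j <;> rfl
  rw [himg, Projectivization.logHeight_mk, Projectivization.logHeight_mk, ← hp]
  linarith

end HeightGrowth

/-! ### Counting orbits of expanding maps -/

section OrbitCount

variable {X ι : Type*}

theorem exists_finset_card_le_of_length_le [Fintype ι] (g : ι → Function.End X) (x₀ : X) (R : ℕ) :
    ∃ T : Finset X, T.card ≤ (Fintype.card ι + 1) ^ R ∧
      ∀ w : FreeMonoid ι, w.length ≤ R → FreeMonoid.lift g w x₀ ∈ T := by
  classical
  induction R with
  | zero =>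
    refine ⟨{x₀}, by simp, fun w hw => ?_⟩
    obtain rfl : w = 1 := FreeMonoid.length_eq_zero.1 (Nat.le_zero.1 hw)
    simp [Function.End.one_def]
  | succ R ih =>
    obtain ⟨T, hT, hmem⟩ := ih
    refine ⟨insert x₀ (Finset.univ.biUnion fun i => T.image (g i)), ?_, fun w hw => ?_⟩
    · have h1 := Finset.card_biUnion_le_card_mul (Finset.univ : Finset ι)
        (fun i => T.image (g i)) _ fun i _ => Finset.card_image_le.trans hT
      rw [Finset.card_univ] at h1
      have h2 := Finset.card_insert_le x₀ (Finset.univ.biUnion fun i => T.image (g i))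
      have h3 : 1 ≤ (Fintype.card ι + 1) ^ R := Nat.one_le_pow _ _ (Nat.succ_pos _)
      rw [pow_succ]
      nlinarith
    · induction w using FreeMonoid.casesOn with
      | one => simp [Function.End.one_def]
      | of_mul i w =>
        rw [FreeMonoid.length_mul, FreeMonoid.length_of] at hw
        refine Finset.mem_insert_of_mem (Finset.mem_biUnion.2 ⟨i, Finset.mem_univ i, ?_⟩)
        rw [map_mul, FreeMonoid.lift_eval_of]
        exact Finset.mem_image_of_mem _ (hmem w (by omega))

/-- Under expanding maps the height of the value of a word grows exponentially with its length,
once short words are discarded. -/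
theorem exists_pow_le_height_lift [Finite ι] {h : X → ℝ} [Northcott h] {g : ι → Function.End X}
    {x₀ : X} {C : ℝ} (hg : ∀ i x, 2 * h x - C ≤ h (g i x))
    (hinj : Function.Injective fun w : FreeMonoid ι => FreeMonoid.lift g w x₀) :
    ∃ L : ℕ, ∀ (r : ℕ) (w : FreeMonoid ι), w.length = L + r →
      (3 / 2 : ℝ) ^ r ≤ h (FreeMonoid.lift g w x₀) := by
  -- Once `h x > 2 * D`, the bound `2 * h x - C` exceeds `(3/2) * h x`; `D ≥ 1` starts the induction
  -- at height at least 1.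
  set D := max C 1
  have hD : 1 ≤ D := le_max_right _ _
  have hCD : C ≤ D := le_max_left _ _
  have hfin : {w : FreeMonoid ι | h (FreeMonoid.lift g w x₀) ≤ 2 * D}.Finite :=
    (Northcott.finite_le (h := h) (2 * D)).preimage hinj.injOn
  obtain ⟨L, hL⟩ := (hfin.image FreeMonoid.length).bddAbove
  have hL' (w : FreeMonoid ι) (hw : L + 1 ≤ w.length) : 2 * D < h (FreeMonoid.lift g w x₀) := by
    by_contra! hle
    have := hL (Set.mem_image_of_mem _ hle)
    omega
  refine ⟨L + 1, fun r => ?_⟩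
  induction r with
  | zero =>
    intro w hw
    have := hL' w hw.ge
    rw [pow_zero]
    linarith
  | succ r ih =>
    intro w hw
    induction w using FreeMonoid.casesOn with
    | one => simp at hw
    | of_mul i w =>
      rw [FreeMonoid.length_mul, FreeMonoid.length_of] at hw
      have h1 := ih w (by omega)
      have h2 := hL' w (by omega)
      have h3 := hg i (FreeMonoid.lift g w x₀)
      rw [map_mul, FreeMonoid.lift_eval_of, pow_succ]
      change _ ≤ h (g i (FreeMonoid.lift g w x₀))
      linarith

/-- The points of bounded height in an orbit without coincidences under finitely many expanding
maps are polynomially many in the bound. -/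
theorem exists_ncard_lift_le_mul_pow [Fintype ι] {h : X → ℝ} [Northcott h]
    {g : ι → Function.End X} {x₀ : X} {C : ℝ} (hg : ∀ i x, 2 * h x - C ≤ h (g i x))
    (hinj : Function.Injective fun w : FreeMonoid ι => FreeMonoid.lift g w x₀) :
    ∃ k : ℕ, 0 < k ∧ ∃ A : ℝ, ∀ B : ℝ, 1 ≤ B →
      ({x | (∃ w : FreeMonoid ι, FreeMonoid.lift g w x₀ = x) ∧ h x ≤ B}.ncard : ℝ) ≤
        A * B ^ k := by
  obtain ⟨L, hL⟩ := exists_pow_le_height_lift hg hinj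
  -- This `k` turns the growth of the number of words, `(card ι + 1) ^ r`, into a power of the
  -- height growth `(3/2) ^ r ≤ B`.
  obtain ⟨k, hk⟩ := pow_unbounded_of_one_lt ((Fintype.card ι : ℝ) + 1)
    (by norm_num : (1 : ℝ) < 3 / 2)
  have hk0 : 0 < k := by
    rcases Nat.eq_zero_or_pos k with rfl | hk0
    · rw [pow_zero] at hk
      have := Nat.cast_nonneg (α := ℝ) (Fintype.card ι)
      linarith
    · exact hk0
  refine ⟨k, hk0, ((Fintype.card ι : ℝ) + 1) ^ L, fun B hB => ?_⟩
  obtain ⟨r, hr, hr'⟩ := exists_nat_pow_near hB (by norm_num : (1 : ℝ) < 3 / 2)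
  obtain ⟨T, hT, hmem⟩ := exists_finset_card_le_of_length_le g x₀ (L + r)
  have hsub : {x | (∃ w : FreeMonoid ι, FreeMonoid.lift g w x₀ = x) ∧ h x ≤ B} ⊆ T := by
    rintro _ ⟨⟨w, rfl⟩, hw⟩
    refine hmem w ?_
    by_contra! hlt
    have h1 := hL (w.length - L) w (by omega)
    have h2 : (3 / 2 : ℝ) ^ (r + 1) ≤ (3 / 2) ^ (w.length - L) :=
      pow_le_pow_right₀ (by norm_num) (by omega)
    linarith
  have hcard := (Set.ncard_le_ncard hsub T.finite_toSet).trans (Set.ncard_coe_finset T ▸ hT)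
  calc _ ≤ ((Fintype.card ι : ℝ) + 1) ^ (L + r) := by exact_mod_cast hcard
    _ ≤ ((Fintype.card ι : ℝ) + 1) ^ L * ((3 / 2) ^ k) ^ r := by
      rw [pow_add]
      gcongr
    _ = ((Fintype.card ι : ℝ) + 1) ^ L * ((3 / 2) ^ r) ^ k := by
      rw [← pow_mul, ← pow_mul, mul_comm k]
    _ ≤ _ := by gcongr

end OrbitCount

theorem mem_orbit_iff_exists_evaluation {K : Type*} [Field K] {n : ℕ} (f : Fin n → RatFunc K)
    (x₀ x : ℙ K (Fin 2 → K)) : x ∈ orbit f x₀ ↔ ∃ w, evaluation f x₀ w = x := by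
  simp only [orbit, generatedMonoid, ← FreeMonoid.mrange_lift, evaluation, Set.mem_ofPred_eq,
    MonoidHom.mem_mrange, exists_exists_eq_and]

/-! ### Heights over a number field, and the density -/

section NumberField

variable {K : Type*} [Field K] [NumberField K]

/-- Away from the point at infinity, this is Northcott for elements of `K`. -/
instance northcott_logHeight : Northcott (Projectivization.logHeight (K := K) (ι := Fin 2)) where
  finite_le B := by
    have hfin := Northcott.finite_le (h := Height.logHeight₁ (K := K)) B
    refine ((hfin.image fun a => Projectivization.mk K ![a, 1] (by simp)).union
      (Set.finite_singleton (Projectivization.mk K ![1, 0] (by simp)))).subset fun x hx => ?_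
    induction x using Projectivization.ind with
    | h w hw =>
    by_cases h1 : w 1 = 0
    · right
      rw [Set.mem_singleton_iff, Projectivization.mk_eq_mk_iff']
      exact ⟨w 0, by ext i; fin_cases i <;> simp [h1]⟩
    · have heq : Projectivization.mk K ![w 0 / w 1, 1] (by simp) = Projectivization.mk K w hw := by
        rw [Projectivization.mk_eq_mk_iff']
        refine ⟨(w 1)⁻¹, ?_⟩
        ext i
        fin_cases i <;> simp [h1, div_eq_inv_mul]
      refine Or.inl ⟨w 0 / w 1, ?_, heq⟩
      rw [← heq, Set.mem_ofPred_eq, Projectivization.logHeight_mk] at hx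
      rwa [Set.mem_ofPred_eq, Height.logHeight₁_eq_logHeight]

theorem absHeight_pos (x : ℙ K (Fin 2 → K)) : 0 < absHeight x :=
  Real.rpow_pos_of_pos x.mulHeight_pos _

theorem logHeight_eq_finrank_mul_log_absHeight (x : ℙ K (Fin 2 → K)) :
    x.logHeight = Module.finrank ℚ K * Real.log (absHeight x) := by
  have hd : (Module.finrank ℚ K : ℝ) ≠ 0 := by exact_mod_cast Module.finrank_pos.ne'
  rw [absHeight, Real.log_rpow x.mulHeight_pos, mul_inv_cancel_left₀ hd,
    x.logHeight_eq_log_mulHeight]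

theorem logHeight_le_of_absHeight_le {x : ℙ K (Fin 2 → K)} {N : ℝ} (h : absHeight x ≤ N) :
    x.logHeight ≤ Module.finrank ℚ K * Real.log N := by
  rw [logHeight_eq_finrank_mul_log_absHeight]
  exact mul_le_mul_of_nonneg_left (Real.log_le_log (absHeight_pos x) h) (Nat.cast_nonneg _)

theorem finite_heightBall (A : Set (ℙ K (Fin 2 → K))) (N : ℝ) : (heightBall A N).Finite :=
  (Northcott.finite_le (h := Projectivization.logHeight (K := K) (ι := Fin 2))
    (Module.finrank ℚ K * Real.log N)).subset fun _ hx => logHeight_le_of_absHeight_le hx.2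

/-- Integrality makes every finite place contribute 1, and the multiplicities of the infinite places
sum to the field degree. -/
theorem mulHeight₁_natCast_le {a : ℕ} {N : ℝ} (hN : 1 ≤ N) (ha : a ≤ N) :
    Height.mulHeight₁ (a : K) ≤ N ^ Module.finrank ℚ K := by
  have hfin : ∏ᶠ v : NumberField.FinitePlace K, max (v (a : K)) 1 = 1 :=
    finprod_eq_one_of_forall_eq_one fun v => max_eq_right (by
      rw [← v.norm_embedding_eq]
      simpa using NumberField.FinitePlace.norm_le_one K v.maximalIdeal
        (a : NumberField.RingOfIntegers K))
  rw [NumberField.mulHeight₁_eq, hfin, mul_one, ← NumberField.InfinitePlace.sum_mult_eq,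
    ← Finset.prod_pow_eq_pow_sum]
  gcongr with v
  simpa using ⟨ha, hN⟩

theorem absHeight_natCast_le {a : ℕ} {N : ℝ} (hN : 1 ≤ N) (ha : a ≤ N) :
    absHeight (Projectivization.mk K ![(a : K), 1] (by simp)) ≤ N := by
  rw [absHeight, Projectivization.mulHeight_mk, ← Height.mulHeight₁_eq_mulHeight]
  refine (Real.rpow_le_rpow (Height.mulHeight₁_nonneg _) (mulHeight₁_natCast_le hN ha)
    (by positivity)).trans_eq ?_
  exact Real.pow_rpow_inv_natCast (by linarith) Module.finrank_pos.ne'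

theorem le_ncard_heightBall_univ {N : ℝ} (hN : 1 ≤ N) :
    N ≤ (heightBall (Set.univ : Set (ℙ K (Fin 2 → K))) N).ncard := by
  let φ : ℕ → ℙ K (Fin 2 → K) := fun a => Projectivization.mk K ![(a : K), 1] (by simp)
  have hφ : Function.Injective φ := fun a b hab => by
    obtain ⟨c, hc⟩ := (Projectivization.mk_eq_mk_iff' K _ _ _ _).1 hab
    have h0 := congrFun hc 0
    have h1 := congrFun hc 1
    simp only [Pi.smul_apply, Matrix.cons_val_zero, Matrix.cons_val_one, smul_eq_mul,
      mul_one] at h0 h1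
    rw [h1, one_mul] at h0
    exact_mod_cast h0.symm
  have hsub : φ '' (Finset.range (⌊N⌋₊ + 1) : Set ℕ) ⊆ heightBall Set.univ N := by
    rintro _ ⟨a, ha, rfl⟩
    have ha' : a ≤ ⌊N⌋₊ := by simpa [Nat.lt_succ_iff] using ha
    exact ⟨Set.mem_univ _, absHeight_natCast_le hN
      ((Nat.le_floor_iff (by linarith)).1 ha')⟩
  have hcard := Set.ncard_le_ncard hsub (finite_heightBall _ N)
  rw [Set.ncard_image_of_injective _ hφ, Set.ncard_coe_finset, Finset.card_range] at hcard
  exact (Nat.lt_floor_add_one N).le.trans (by exact_mod_cast hcard)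

theorem hasHeightDensity_zero_of_isBigO {A : Set (ℙ K (Fin 2 → K))} {k : ℕ}
    (h : (fun N : ℝ => ((heightBall A N).ncard : ℝ)) =O[atTop] fun N : ℝ => Real.log N ^ k) :
    HasHeightDensity A 0 := by
  have h1 : (fun N : ℝ => ((heightBall A N).ncard : ℝ)) =o[atTop] fun N : ℝ => N :=
    h.trans_isLittleO (Real.isLittleO_pow_log_id_atTop (n := k))
  have h2 : (fun N : ℝ => N) =O[atTop]
      fun N : ℝ => ((heightBall (Set.univ : Set (ℙ K (Fin 2 → K))) N).ncard : ℝ) :=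
    IsBigO.of_bound 1 <| by
      filter_upwards [eventually_ge_atTop (1 : ℝ)] with N hN
      rw [one_mul, Real.norm_of_nonneg (by linarith), Real.norm_of_nonneg (Nat.cast_nonneg _)]
      exact le_ncard_heightBall_univ hN
  have h3 : Tendsto (heightProportion A) atTop (𝓝 0) := (h1.trans_isBigO h2).tendsto_div_nhds_zero
  exact ⟨h3.liminf_eq, h3.limsup_eq⟩

theorem exists_ncard_heightBall_orbit_isBigO {n : ℕ} {f : Fin n → RatFunc K}
    {x₀ : ℙ K (Fin 2 → K)} (hdeg : ∀ i, 2 ≤ degree (f i)) (hinj : IsInjectiveAt f x₀) :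
    ∃ k : ℕ, 0 < k ∧
      (fun N : ℝ => ((heightBall (orbit f x₀) N).ncard : ℝ)) =O[atTop]
        fun N : ℝ => Real.log N ^ k := by
  choose C hC using fun i => exists_degree_mul_logHeight_sub_le (f i)
  obtain ⟨D, hD⟩ := (Set.finite_range C).bddAbove
  have hg (i : Fin n) (x : ℙ K (Fin 2 → K)) :
      2 * x.logHeight - D ≤ (toMap (f i) x).logHeight := by
    have h1 : C i ≤ D := hD (Set.mem_range_self i)
    have h2 : (2 : ℝ) * x.logHeight ≤ degree (f i) * x.logHeight :=
      mul_le_mul_of_nonneg_right (by exact_mod_cast hdeg i) x.logHeight_nonneg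
    linarith [hC i x]
  obtain ⟨k, hk, A, hA⟩ := exists_ncard_lift_le_mul_pow hg hinj
  refine ⟨k, hk, IsBigO.of_bound (A * Module.finrank ℚ K ^ k) ?_⟩
  -- `log N ≥ 1` makes the height bound `[K : ℚ] * log N` at least 1, as `hA` requires.
  filter_upwards [Real.tendsto_log_atTop.eventually_ge_atTop 1] with N hN
  have hd : (1 : ℝ) ≤ Module.finrank ℚ K := by exact_mod_cast Module.finrank_pos (R := ℚ) (M := K)
  rw [Real.norm_of_nonneg (Nat.cast_nonneg _), Real.norm_of_nonneg (by positivity), mul_assoc,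
    ← mul_pow]
  refine le_trans ?_ (hA (Module.finrank ℚ K * Real.log N) (by nlinarith))
  refine Nat.cast_le.2 (Set.ncard_le_ncard (fun x hx => ?_) ?_)
  · exact ⟨(mem_orbit_iff_exists_evaluation f x₀ x).1 hx.1, logHeight_le_of_absHeight_le hx.2⟩
  · exact (Northcott.finite_le (h := Projectivization.logHeight (K := K) (ι := Fin 2)) _).subset
      fun x hx => hx.2

end NumberField

end RationalOrbit

theorem mainTheorem1 {K : Type*} [Field K] [NumberField K] {n : ℕ}
    (f : Fin n → RatFunc K) (x₀ : ℙ K (Fin 2 → K))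
    (hdeg : ∀ i, 2 ≤ RationalOrbit.degree (f i))
    (hinj : RationalOrbit.IsInjectiveAt f x₀) :
    (∀ N : ℝ, (RationalOrbit.heightBall (Set.univ : Set (ℙ K (Fin 2 → K))) N).Finite) ∧
    RationalOrbit.HasHeightDensity (RationalOrbit.orbit f x₀) 0 ∧
    ∃ k : ℕ, 0 < k ∧
      (fun N : ℝ => ((RationalOrbit.heightBall (RationalOrbit.orbit f x₀) N).ncard : ℝ))
        =O[atTop] fun N : ℝ => Real.log N ^ k := by
  obtain ⟨k, hk, hO⟩ := RationalOrbit.exists_ncard_heightBall_orbit_isBigO hdeg hinj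
  exact ⟨fun N => RationalOrbit.finite_heightBall _ N,
    RationalOrbit.hasHeightDensity_zero_of_isBigO hO, k, hk, hO⟩
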